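/- For a prime $p$ let $\mathbb Z_p$ be the set of rational numbers whose denominator is not divisible by $p$; for $a,b\in\mathbb Q$ write $a\equiv b \pmod p$ if $a-b\in p\,\mathbb Z_p$. Let $[x]$ be the greatest integer not exceeding $x$ and let $\left(\frac{m}{p}\right)$ be the Legendre symbol. For a Gaussian prime $\pi\in\mathbb Z[i]$ of odd norm $N(\pi)$ and $\alpha\in\mathbb Z[i]$ let $\left(\frac{\alpha}{\pi}\right)_4=0$ if $\pi\mid\alpha$; otherwise let $\left(\frac{\alpha}{\pi}\right)_4$ be the unique element of $\{1,i,-1,-i\}$ that is congruent to $\alpha^{(N(\pi)-1)/4}$ modulo $\pi$. For an odd prime $p$ the quartic Jacobi symbol $\left(\frac{\alpha}{p}\right)_4$ is the product of the symbols $\left(\frac{\alpha}{\pi}\right)_4$ over the Gaussian primes $\pi$ in a factorization of $p$ in $\mathbb Z[i]$. It depends only on $\alpha$ modulo $p$, and for $c\in\mathbb Z_p$ one sets $\left(\frac{c+i}{p}\right)_4=\left(\frac{a+i}{p}\right)_4$ for any integer $a\equiv c\pmod p$. For $r=0,1,2,3$ let $$Q_r(p)=\Big\{c\in\mathbb Z_p:\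 \Big(\frac{c+i}{p}\Big)_4=i^r\Big\}.$$ **Theorem 2.1.** Let $p$ be an odd prime and let $c\in\mathbb Z_p$ satisfy $c(c^2+1)\not\equiv 0\pmod p$. Then $c$ belongs to exactly one of $Q_0(p),Q_1(p),Q_2(p),Q_3(p)$, and $$\Big(\frac 2p\Big)\sum_{k=0}^{[p/4]}\binom{4k}{2k}\Big(\frac{c^2}{16(c^2+1)}\Big)^k\equiv\begin{cases}1\pmod p&\text{if }c\in Q_0(p),\\ c\pmod p&\text{if }c\in Q_1(p),\\ -1\pmod p&\text{if }c\in Q_2(p),\\ -c\pmod p&\text{if }c\in Q_3(p),\end{cases}$$ and $$\sum_{k=0}^{[p/4]}\binom{4k}{2k}\frac1{(16(c^2+1))^k}\equiv\begin{cases}1\pmod p&\text{if }c\in Q_0(p),\\ -\frac1c\pmod p&\text{if }c\in Q_1(p),\\ -1\pmod p&\text{if }c\in Q_2(p),\\ \frac1c\pmod p&\text{if }c\in Q_3(p).\end{cases}$$ -/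

import Mathlib

/-- The set `ℤ_p` of rational numbers whose denominator is not divisible by `p`. -/
def pIntegers (p : ℕ) : Set ℚ := {x | ¬ p ∣ x.den}

/-- `a ≡ b (mod p)` in `ℤ_p`: the difference `a - b` lies in `p ℤ_p`. -/
def pCongr (p : ℕ) (a b : ℚ) : Prop := ∃ t ∈ pIntegers p, a - b = p * t

/-- The imaginary unit `i` of the ring `ℤ[i]` of Gaussian integers. -/
def gaussI : GaussianInt := ⟨0, 1⟩

open Classical in
/-- The quartic residue symbol `(α/π)₄` for a Gaussian prime `π` of odd norm `N(π)`:
it is `0` if `π ∣ α`, and otherwise it is the unique power `i ^ r` of `i` with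
`α ^ ((N(π) - 1) / 4) ≡ i ^ r (mod π)`. The last branch is never reached for such `π`. -/
noncomputable def quarticResidueSymbol (α π : GaussianInt) : GaussianInt :=
  if π ∣ α then 0
  else if π ∣ α ^ ((π.norm.natAbs - 1) / 4) - 1 then 1
  else if π ∣ α ^ ((π.norm.natAbs - 1) / 4) - gaussI then gaussI
  else if π ∣ α ^ ((π.norm.natAbs - 1) / 4) - (-1) then -1
  else if π ∣ α ^ ((π.norm.natAbs - 1) / 4) - (-gaussI) then -gaussI
  else 0

/-- The quartic Jacobi symbol `(α/β)₄` for `β ≠ 0` of odd norm: the product of the quartic residue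
symbols `(α/π)₄` over the Gaussian primes `π` in a factorization of `β`, with multiplicity.
(Each factor depends on `π` only up to a unit, so the choice of factorization is immaterial.) -/
noncomputable def quarticJacobiSymbol (α β : GaussianInt) : GaussianInt :=
  ((UniqueFactorizationMonoid.factors β).map (quarticResidueSymbol α)).prod

/-- The symbol `((x + y i)/p)₄` for a prime `p` and `x, y ∈ ℤ_p`. As `(α/p)₄` depends only on `α`
modulo `p`, it is the symbol of `a + b i`, where `a, b` are the least non-negative integers with
`a ≡ x` and `b ≡ y (mod p)`. -/
noncomputable def quarticSymbolAt (p : ℕ) [Fact p.Prime] (x y : ℚ) : GaussianInt :=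
  quarticJacobiSymbol ⟨((x : ZMod p).val : ℤ), ((y : ZMod p).val : ℤ)⟩ (p : GaussianInt)

/-- `Q_r(p)`, the set of `c ∈ ℤ_p` with `((c + i)/p)₄ = i ^ r`. -/
def quarticClass (p : ℕ) [Fact p.Prime] (r : ℕ) : Set ℚ :=
  {c | c ∈ pIntegers p ∧ quarticSymbolAt p c 1 = gaussI ^ r}

/-! Work in an algebraic closure `K` of the field with `p` elements, with `t² = -1` and `w⁴ = (c +
t)/(c - t)`. Since `(p - 1)/2` is `-1/2` in `K`, the sum of `binom(4k, 2k) xᵏ` is the even part of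
`(1 + y)^((p-1)/2)`, where `y² = 16x` (`two_mul_sum_choose_mul_pow`). For `x = c²/(16(c² + 1))` take
`2y = w² + w⁻²`; then `2(1 ± y) = ±(w ± w⁻¹)²`, so after multiplication by `2^((p-1)/2)`, which is
`(2/p)`, only powers `(w ± w⁻¹)^(p-1)` remain, and Frobenius evaluates them in terms of `w ^ p`
(`two_pow_mul_sum`).

Euler's criterion in the residue fields of `ℤ[i]` shows that `w ^ p` is `Z w` or `(Z w)⁻¹`, where `Z
= t ^ r` is the image of the quartic symbol (`frobeniusTwist_quarticJacobiSymbol`). Each power of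
`t` then gives one case. The second sum is the first one at `-1/c`. -/

namespace QuarticSum

/-! ### The two sums in characteristic `p` -/

section CharP

variable {p : ℕ} {K : Type*} [Field K] [CharP K p]

theorem two_mul_half_cast [Fact p.Prime] (hp : p ≠ 2) : 2 * ((p / 2 : ℕ) : K) = -1 := by
  have hodd : p % 2 = 1 := (Nat.Prime.mod_two_eq_one_iff_ne_two (Fact.out : p.Prime)).2 hp
  have h : 2 * (p / 2) + 1 = p := by omega
  have h' : ((2 * (p / 2) + 1 : ℕ) : K) = 0 := by rw [h]; exact CharP.cast_eq_zero K p
  push_cast at h'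
  linear_combination h'

theorem two_ne_zero_of_charP [Fact p.Prime] (hp : p ≠ 2) : (2 : K) ≠ 0 := by
  intro h
  have := two_mul_half_cast (K := K) hp
  simp [h] at this

/-- This is `binom(2m, m) = (-4)^m binom(-1/2, m)` with `p / 2` in the role of `-1/2`. The bound on
`m` keeps the denominators invertible in the induction. -/
theorem centralBinom_cast [Fact p.Prime] (hp : p ≠ 2) {m : ℕ} (hm : m ≤ p / 2) :
    (m.centralBinom : K) = ((p / 2).choose m : K) * (-4) ^ m := by
  induction m with
  | zero => simp
  | succ m ih =>
    have ih := ih (by omega)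
    have hpp : p.Prime := Fact.out
    have hne : ((m + 1 : ℕ) : K) ≠ 0 := by
      rw [Ne, CharP.cast_eq_zero_iff K p]
      intro h
      have := Nat.le_of_dvd (by omega) h
      have := hpp.two_le
      omega
    apply mul_left_cancel₀ hne
    have h1 : (((m + 1) * (m + 1).centralBinom : ℕ) : K)
        = ((2 * (2 * m + 1) * m.centralBinom : ℕ) : K) := by
      rw [Nat.succ_mul_centralBinom_succ]
    have h2 : (((p / 2).choose (m + 1) * (m + 1) : ℕ) : K)
        = (((p / 2).choose m * (p / 2 - m) : ℕ) : K) := by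
      rw [Nat.choose_succ_right_eq]
    rw [Nat.cast_mul, Nat.cast_mul, Nat.cast_sub (by omega)] at h2
    have h3 := two_mul_half_cast (K := K) hp
    push_cast at h1 h2 ⊢
    rw [pow_succ]
    linear_combination h1 + 2 * (2 * (m : K) + 1) * ih + 4 * (-4) ^ m * h2
      + 2 * (-4) ^ m * ((p / 2).choose m : K) * h3

theorem sum_range_two_mul {M : Type*} [AddCommMonoid M] (f : ℕ → M) (N : ℕ) :
    ∑ j ∈ Finset.range (2 * N), f j = ∑ k ∈ Finset.range N, (f (2 * k) + f (2 * k + 1)) := by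
  induction N with
  | zero => simp
  | succ N ih =>
    rw [Finset.sum_range_succ, ← ih, show 2 * (N + 1) = 2 * N + 1 + 1 by ring,
      Finset.sum_range_succ, Finset.sum_range_succ, add_assoc]

theorem add_pow_add_sub_pow {R : Type*} [CommRing R] (y : R) {n N : ℕ} (h : n < 2 * N) :
    (1 + y) ^ n + (1 - y) ^ n = 2 * ∑ k ∈ Finset.range N, (n.choose (2 * k) : R) * (y ^ 2) ^ k := by
  have key : ∀ z : R, (1 + z) ^ n = ∑ j ∈ Finset.range (2 * N), z ^ j * (n.choose j : R) := by
    intro z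
    rw [add_comm, add_pow]
    simp only [one_pow, mul_one]
    apply Finset.sum_subset
    · intro j hj
      simp only [Finset.mem_range] at *
      omega
    · intro j _ hj
      simp only [Finset.mem_range] at hj
      rw [Nat.choose_eq_zero_of_lt (by omega)]
      simp
  rw [sub_eq_add_neg, key, key, sum_range_two_mul, sum_range_two_mul, ← Finset.sum_add_distrib,
    Finset.mul_sum]
  refine Finset.sum_congr rfl fun k _ => ?_
  have h1 : (-y) ^ (2 * k) = y ^ (2 * k) := (even_two_mul k).neg_pow y
  have h2 : (-y) ^ (2 * k + 1) = -y ^ (2 * k + 1) := (odd_two_mul_add_one k).neg_pow y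
  rw [h1, h2, ← pow_mul]
  ring

theorem two_mul_sum_choose_mul_pow [Fact p.Prime] (hp : p ≠ 2) {x y : K} (hy : y ^ 2 = 16 * x) :
    2 * ∑ k ∈ Finset.range (p / 4 + 1), ((4 * k).choose (2 * k) : K) * x ^ k
      = (1 + y) ^ (p / 2) + (1 - y) ^ (p / 2) := by
  have hpp : p.Prime := Fact.out
  have hodd : p % 2 = 1 := (Nat.Prime.mod_two_eq_one_iff_ne_two hpp).2 hp
  rw [add_pow_add_sub_pow y (N := p / 4 + 1) (by omega)]
  congr 1
  refine Finset.sum_congr rfl fun k hk => ?_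
  rw [Finset.mem_range] at hk
  have := centralBinom_cast (K := K) hp (m := 2 * k) (by omega)
  rw [Nat.centralBinom_eq_two_mul_choose, ← mul_assoc] at this
  rw [show 4 * k = 2 * 2 * k by ring, this, hy, mul_pow, pow_mul]
  norm_num
  ring

/-- The image `Z` in characteristic `p` of a quartic symbol attached to `w ^ 4`: the Frobenius
sends `w` to `Z w` or to `(Z w)⁻¹`, according to `p` modulo `4`. -/
def FrobeniusTwist (p : ℕ) (w Z : K) : Prop :=
  (p % 4 = 1 ∧ w ^ p = Z * w) ∨ (p % 4 = 3 ∧ Z * w * w ^ p = 1)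

theorem two_pow_mul_sum [Fact p.Prime] (hp : p ≠ 2) {c t w Z : K} (ht : t ^ 2 = -1)
    (hc : c ^ 2 + 1 ≠ 0) (hw : w ^ 4 * (c - t) = c + t) (hZ : FrobeniusTwist p w Z) :
    2 * (2 ^ (p / 2) * ∑ k ∈ Finset.range (p / 4 + 1),
        ((4 * k).choose (2 * k) : K) * (c ^ 2 / (16 * (c ^ 2 + 1))) ^ k)
      = (Z * w + (Z * w)⁻¹) / (w + w⁻¹) + (Z * w - (Z * w)⁻¹) / (w - w⁻¹) := by
  have hpp : p.Prime := Fact.out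
  have hodd : p % 2 = 1 := (Nat.Prime.mod_two_eq_one_iff_ne_two hpp).2 hp
  have h2 : (2 : K) ≠ 0 := two_ne_zero_of_charP hp
  have h16 : (16 : K) ≠ 0 := by
    rw [show (16 : K) = 2 ^ 4 by norm_num]; exact pow_ne_zero _ h2
  have hfac : (c + t) * (c - t) = c ^ 2 + 1 := by linear_combination -ht
  have hp1 : c + t ≠ 0 := fun h => hc (by rw [← hfac, h, zero_mul])
  have hm1 : c - t ≠ 0 := fun h => hc (by rw [← hfac, h, mul_zero])
  have ht0 : t ≠ 0 := by rintro rfl; norm_num at ht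
  have hw0 : w ≠ 0 := by rintro rfl; apply hp1; rw [← hw]; ring
  have hw4 : w ^ 4 ≠ 1 := by
    intro h
    rw [h] at hw
    exact mul_ne_zero h2 ht0 (by linear_combination -hw)
  have hP : w + w⁻¹ ≠ 0 := by
    intro h
    field_simp at h
    exact hw4 (by linear_combination (w ^ 2 - 1) * h)
  have hM : w - w⁻¹ ≠ 0 := by
    intro h
    field_simp at h
    exact hw4 (by linear_combination (w ^ 2 + 1) * h)
  -- Chosen so that `2y = w² + w⁻²`.
  set y : K := c * w ^ 2 / (c + t) with hy
  have hy2 : y ^ 2 = 16 * (c ^ 2 / (16 * (c ^ 2 + 1))) := by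
    rw [hy, ← hfac]
    field_simp
    linear_combination c ^ 2 * hw
  have e1 : 2 * (1 + y) = (w + w⁻¹) ^ 2 := by
    rw [hy]; field_simp
    linear_combination hw
  have e2 : 2 * (1 - y) = -(w - w⁻¹) ^ 2 := by
    rw [hy]; field_simp
    linear_combination -hw
  rw [mul_left_comm, two_mul_sum_choose_mul_pow hp hy2, mul_add, ← mul_pow, ← mul_pow, e1, e2,
    neg_pow, ← pow_mul, ← pow_mul]
  have hexp : 2 * (p / 2) = p - 1 := by omega
  have hpos : p ≠ 0 := hpp.ne_zero
  have pP : (w + w⁻¹) ^ (p - 1) = (w ^ p + (w ^ p)⁻¹) / (w + w⁻¹) := by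
    rw [eq_div_iff hP, pow_sub_one_mul hpos, add_pow_char, inv_pow]
  have pM : (w - w⁻¹) ^ (p - 1) = (w ^ p - (w ^ p)⁻¹) / (w - w⁻¹) := by
    rw [eq_div_iff hM, pow_sub_one_mul hpos, sub_pow_char, inv_pow]
  rw [hexp, pP, pM]
  -- If `p ≡ 3 (mod 4)`, Frobenius inverts `Z w`, which changes the sign of the difference; the sign
  -- `(-1)^(p/2)` cancels this.
  rcases hZ with ⟨hp4, hZ⟩ | ⟨hp4, hZ⟩
  · rw [hZ, Even.neg_one_pow (Nat.even_iff.2 (by omega))]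
    ring
  · rw [eq_inv_of_mul_eq_one_right hZ, Odd.neg_one_pow (Nat.odd_iff.2 (by omega)), inv_inv]
    ring

/-- If `Z² = 1`, both quotients in `two_pow_mul_sum` equal `Z`. If `Z² = -1`, then `Z⁻¹ = -Z`
exchanges the numerators, and the total is `2Z(w⁴ + 1)/(w⁴ - 1) = 2Zc/t`. -/
theorem two_pow_mul_sum_of_sq [Fact p.Prime] (hp : p ≠ 2) {c t w Z : K} (ht : t ^ 2 = -1)
    (hc : c ^ 2 + 1 ≠ 0) (hw : w ^ 4 * (c - t) = c + t) (hZ : FrobeniusTwist p w Z) :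
    (Z ^ 2 = 1 → 2 ^ (p / 2) * ∑ k ∈ Finset.range (p / 4 + 1),
        ((4 * k).choose (2 * k) : K) * (c ^ 2 / (16 * (c ^ 2 + 1))) ^ k = Z) ∧
    (Z ^ 2 = -1 → 2 ^ (p / 2) * ∑ k ∈ Finset.range (p / 4 + 1),
        ((4 * k).choose (2 * k) : K) * (c ^ 2 / (16 * (c ^ 2 + 1))) ^ k = Z * c / t) := by
  have h2 : (2 : K) ≠ 0 := two_ne_zero_of_charP hp
  have hfac : (c + t) * (c - t) = c ^ 2 + 1 := by linear_combination -ht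
  have hp1 : c + t ≠ 0 := fun h => hc (by rw [← hfac, h, zero_mul])
  have ht0 : t ≠ 0 := by rintro rfl; norm_num at ht
  have hw0 : w ≠ 0 := by rintro rfl; apply hp1; rw [← hw]; ring
  have hw4 : w ^ 4 ≠ 1 := by
    intro h
    rw [h] at hw
    exact mul_ne_zero h2 ht0 (by linear_combination -hw)
  have hP : w ^ 2 + 1 ≠ 0 := fun h => hw4 (by linear_combination (w ^ 2 - 1) * h)
  have hM : w ^ 2 - 1 ≠ 0 := fun h => hw4 (by linear_combination (w ^ 2 + 1) * h)
  have eP : w + w⁻¹ = (w ^ 2 + 1) / w := by field_simp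
  have eM : w - w⁻¹ = (w ^ 2 - 1) / w := by field_simp
  constructor
  · intro hZ2
    have hZi : Z⁻¹ = Z := inv_eq_of_mul_eq_one_right (by rw [← sq, hZ2])
    apply mul_left_cancel₀ h2
    rw [two_pow_mul_sum hp ht hc hw hZ, mul_inv, hZi, eP, eM]
    field_simp
    ring
  · intro hZ2
    have hZi : Z⁻¹ = -Z := inv_eq_of_mul_eq_one_right (by linear_combination -hZ2)
    apply mul_left_cancel₀ h2
    rw [two_pow_mul_sum hp ht hc hw hZ, mul_inv, hZi, eP, eM]
    field_simp
    linear_combination -2 * Z * hw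

theorem legendreSym_two_cast [Fact p.Prime] : ((legendreSym p 2 : ℤ) : K) = 2 ^ (p / 2) := by
  have := congrArg (ZMod.castHom (dvd_refl p) K) (legendreSym.eq_pow p 2)
  rwa [map_intCast, map_pow, map_intCast, Int.cast_ofNat] at this

/-- Here `p = 4e ± 1`, so this computes `η ^ p` when `η⁴ = -1`. -/
theorem neg_one_pow_eq_two_pow [Fact p.Prime] (hp : p ≠ 2) {e : ℕ}
    (he : (p % 4 = 1 ∧ e = (p - 1) / 4) ∨ (p % 4 = 3 ∧ e = (p + 1) / 4)) :
    ((-1) ^ e : K) = 2 ^ (p / 2) := by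
  have hpp : p.Prime := Fact.out
  rw [← legendreSym_two_cast (p := p), legendreSym.at_two hp, ZMod.χ₈_nat_eq_if_mod_eight]
  have hodd : p % 2 = 1 := (Nat.Prime.mod_two_eq_one_iff_ne_two hpp).2 hp
  rw [if_neg (by omega)]
  split_ifs with h
  · rw [Even.neg_one_pow (Nat.even_iff.2 (by omega))]; simp
  · rw [Odd.neg_one_pow (Nat.odd_iff.2 (by omega))]; simp

/-- The substitution `c ↦ -1/c` turns `c²/(c² + 1)` into `1/(c² + 1)` and negates `(c + t)/(c - t)`.
Hence `w` becomes `w η` and `Z` becomes `Z ε`, and the factor `ε = (2/p)` cancels. -/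
theorem sum_inv_of_sq [Fact p.Prime] (hp : p ≠ 2) {c t w η Z : K} (ht : t ^ 2 = -1)
    (hc0 : c ≠ 0) (hc : c ^ 2 + 1 ≠ 0) (hw : w ^ 4 * (c - t) = c + t) (hη : η ^ 4 = -1)
    (hZ : FrobeniusTwist p w Z) :
    (Z ^ 2 = 1 → ∑ k ∈ Finset.range (p / 4 + 1),
        ((4 * k).choose (2 * k) : K) * (1 / (16 * (c ^ 2 + 1)) ^ k) = Z) ∧
    (Z ^ 2 = -1 → ∑ k ∈ Finset.range (p / 4 + 1),
        ((4 * k).choose (2 * k) : K) * (1 / (16 * (c ^ 2 + 1)) ^ k) = -Z / (c * t)) := by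
  have h2 : (2 : K) ≠ 0 := two_ne_zero_of_charP hp
  have hpp : p.Prime := Fact.out
  have ht0 : t ≠ 0 := by rintro rfl; norm_num at ht
  set ε : K := 2 ^ (p / 2) with hε
  have hε0 : ε ≠ 0 := pow_ne_zero _ h2
  have hodd : p % 2 = 1 := (Nat.Prime.mod_two_eq_one_iff_ne_two hpp).2 hp
  have hε2 : ε ^ 2 = 1 := by
    rcases (by omega : p % 4 = 1 ∨ p % 4 = 3) with h | h
    · rw [hε, ← neg_one_pow_eq_two_pow hp (Or.inl ⟨h, rfl⟩), ← pow_mul, mul_comm, pow_mul]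
      simp
    · rw [hε, ← neg_one_pow_eq_two_pow hp (Or.inr ⟨h, rfl⟩), ← pow_mul, mul_comm, pow_mul]
      simp
  have hZ' : FrobeniusTwist p (w * η) (Z * ε) := by
    rcases hZ with ⟨h, hZ⟩ | ⟨h, hZ⟩
    · refine Or.inl ⟨h, ?_⟩
      have e : η ^ p = ε * η := by
        rw [hε, ← neg_one_pow_eq_two_pow hp (Or.inl ⟨h, rfl⟩), ← hη, ← pow_mul, ← pow_succ]
        congr 1; omega
      rw [mul_pow, hZ, e]; ring
    · refine Or.inr ⟨h, ?_⟩
      have e : η * η ^ p = ε := by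
        rw [hε, ← neg_one_pow_eq_two_pow hp (Or.inr ⟨h, rfl⟩), ← hη, ← pow_mul, ← pow_succ']
        congr 1; omega
      rw [mul_pow]
      linear_combination ε * η * η ^ p * hZ + ε * e + hε2
  have hc' : (-c⁻¹) ^ 2 + 1 ≠ 0 := by
    intro h
    field_simp at h
    exact hc (by linear_combination h)
  have hw' : (w * η) ^ 4 * (-c⁻¹ - t) = -c⁻¹ + t := by
    rw [mul_pow, hη]
    field_simp
    linear_combination t * hw + (w ^ 4 + 1) * ht
  have hx : ∀ k : ℕ, ((-c⁻¹) ^ 2 / (16 * ((-c⁻¹) ^ 2 + 1))) ^ k = 1 / (16 * (c ^ 2 + 1)) ^ k := by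
    intro k
    rw [← one_div_pow]
    congr 1
    have : (-c⁻¹) ^ 2 + 1 = (c ^ 2 + 1) / c ^ 2 := by field_simp; ring
    rw [this]
    field_simp
  obtain ⟨h1, h3⟩ := two_pow_mul_sum_of_sq hp ht hc' hw' hZ'
  simp only [hx] at h1 h3
  constructor
  · intro hZ2
    apply mul_left_cancel₀ hε0
    rw [h1 (by rw [mul_pow, hZ2, hε2, one_mul])]
    ring
  · intro hZ2
    apply mul_left_cancel₀ hε0
    rw [h3 (by rw [mul_pow, hZ2, hε2, mul_one])]
    field_simp

end CharP

/-! ### Quartic symbols and Frobenius -/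

section Gaussian

/-- The ring homomorphism `ℤ[i] → K` sending `i` to a square root `t` of `-1`. -/
def gaussHom {K : Type*} [CommRing K] (t : K) (ht : t ^ 2 = -1) : GaussianInt →+* K :=
  Zsqrtd.lift ⟨t, by rw [← sq, ht]; simp⟩

theorem gaussHom_apply {K : Type*} [CommRing K] (t : K) (ht : t ^ 2 = -1) (x : GaussianInt) :
    gaussHom t ht x = x.re + x.im * t :=
  Zsqrtd.lift_apply_apply _ _

theorem gaussHom_gaussI {K : Type*} [CommRing K] (t : K) (ht : t ^ 2 = -1) :
    gaussHom t ht gaussI = t := by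
  simp [gaussHom_apply, gaussI]

theorem gaussI_sq : gaussI ^ 2 = -1 := by decide

theorem gaussI_pow_four : gaussI ^ 4 = 1 := by decide

theorem gaussI_pow_mod_four (r : ℕ) : gaussI ^ (r % 4) = gaussI ^ r := by
  conv_rhs => rw [← Nat.div_add_mod r 4, pow_add, pow_mul, gaussI_pow_four, one_pow, one_mul]

theorem gaussI_pow_injective (i j : Fin 4) (h : gaussI ^ (i : ℕ) = gaussI ^ (j : ℕ)) : i = j := by
  revert i j; decide

theorem quarticResidueSymbol_eq_of_associated (α : GaussianInt) {π π' : GaussianInt}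
    (h : Associated π π') : quarticResidueSymbol α π = quarticResidueSymbol α π' := by
  classical
  unfold quarticResidueSymbol
  rw [Zsqrtd.norm_eq_of_associated (by norm_num) h]
  have hd : ∀ x : GaussianInt, π ∣ x ↔ π' ∣ x := fun _ => h.dvd_iff_dvd_left
  exact if_congr (hd _) rfl (if_congr (hd _) rfl (if_congr (hd _) rfl (if_congr (hd _) rfl
    (if_congr (hd _) rfl rfl))))

theorem quarticJacobiSymbol_eq_prod (α β : GaussianInt) (hβ : β ≠ 0) (s : Multiset GaussianInt)
    (hs : ∀ π ∈ s, Prime π) (hprod : s.prod = β) :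
    quarticJacobiSymbol α β = (s.map (quarticResidueSymbol α)).prod := by
  have hrel : Multiset.Rel Associated (UniqueFactorizationMonoid.factors β) s := by
    apply UniqueFactorizationMonoid.factors_unique UniqueFactorizationMonoid.irreducible_of_factor
      (fun x hx => (hs x hx).irreducible)
    rw [hprod]
    exact UniqueFactorizationMonoid.factors_prod hβ
  unfold quarticJacobiSymbol
  congr 1
  rw [← Multiset.rel_eq, Multiset.rel_map]
  exact hrel.mono fun a _ b _ hab => quarticResidueSymbol_eq_of_associated α hab

/-- The ideal `(π)` is maximal and the kernel of `φ` is proper, so they coincide. -/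
theorem dvd_iff_map_eq_zero {R K : Type*} [CommRing R] [IsDomain R] [IsPrincipalIdealRing R]
    [Field K] (φ : R →+* K) {π : R} (hπ : Prime π) (h : φ π = 0) (x : R) : π ∣ x ↔ φ x = 0 := by
  constructor
  · rintro ⟨y, rfl⟩
    rw [map_mul, h, zero_mul]
  · intro hx
    by_contra hnd
    obtain ⟨u, v, huv⟩ := (hπ.irreducible.coprime_iff_not_dvd).2 hnd
    have := congrArg φ huv
    simp [h, hx] at this

/-- Divisibility by `π` is vanishing in `K`, and a fourth root of unity in `K` is a power of `t`. -/
theorem quarticResidueSymbol_spec {K : Type*} [Field K] {t : K} (ht : t ^ 2 = -1)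
    {α π : GaussianInt} (hπ : Prime π) (hφ : gaussHom t ht π = 0) {e : ℕ}
    (he : (π.norm.natAbs - 1) / 4 = e) (hα : gaussHom t ht α ≠ 0)
    (h4 : gaussHom t ht α ^ (4 * e) = 1) :
    ∃ r : ℕ, quarticResidueSymbol α π = gaussI ^ r ∧ gaussHom t ht α ^ e = t ^ r := by
  unfold quarticResidueSymbol
  rw [he]
  have hd : ∀ x : GaussianInt, π ∣ x ↔ gaussHom t ht x = 0 :=
    dvd_iff_map_eq_zero (gaussHom t ht) hπ hφ
  set y := gaussHom t ht α ^ e with hy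
  have hval : ∀ z : GaussianInt, π ∣ α ^ e - z ↔ y = gaussHom t ht z := by
    intro z
    rw [hd, map_sub, map_pow, sub_eq_zero]
  have hy4 : (y - 1) * (y - t) * (y - -1) * (y - -t) = 0 := by
    rw [mul_comm, pow_mul, ← hy] at h4
    linear_combination h4 - (y ^ 2 - 1) * ht
  rw [if_neg (mt (hd α).1 hα)]
  split_ifs with h1 h2 h3 h5
  · rw [hval, map_one] at h1
    exact ⟨0, by simp, by simp [h1]⟩
  · rw [hval, gaussHom_gaussI] at h2
    exact ⟨1, by simp, by simp [h2]⟩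
  · rw [hval, map_neg, map_one] at h3
    exact ⟨2, by rw [gaussI_sq], by rw [h3, ht]⟩
  · rw [hval, map_neg, gaussHom_gaussI] at h5
    exact ⟨3, by rw [pow_succ, gaussI_sq, neg_one_mul], by rw [h5, pow_succ, ht, neg_one_mul]⟩
  · rw [hval, map_one] at h1
    rw [hval, gaussHom_gaussI] at h2
    rw [hval, map_neg, map_one] at h3
    rw [hval, map_neg, gaussHom_gaussI] at h5
    simp only [mul_eq_zero, sub_eq_zero] at hy4
    tauto

theorem gaussianInt_prime_of_norm_natAbs_prime {π : GaussianInt} (h : π.norm.natAbs.Prime) :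
    Prime π := by
  rw [← irreducible_iff_prime]
  refine ⟨fun hu => ?_, fun a b hab => ?_⟩
  · rw [← Zsqrtd.norm_eq_one_iff] at hu
    exact h.ne_one hu
  · rw [hab, Zsqrtd.norm_mul, Int.natAbs_mul, Nat.prime_mul_iff] at h
    rw [← Zsqrtd.norm_eq_one_iff, ← Zsqrtd.norm_eq_one_iff]
    tauto

variable {p : ℕ} {K : Type*} [Field K] [CharP K p]

/-- The sign of `y` selects, of the two conjugate primes above `p`, the one killed by `i ↦ t`. -/
theorem exists_sq_add_sq_and_root [Fact p.Prime] (h4 : p % 4 = 1) {t : K} (ht : t ^ 2 = -1) :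
    ∃ x y : ℤ, x ^ 2 + y ^ 2 = p ∧ (x : K) + y * t = 0 := by
  obtain ⟨a, b, hab⟩ := Nat.Prime.sq_add_sq (p := p) (by omega)
  have h0 : ((a : K) + b * t) * (a + (-b) * t) = 0 := by
    have h : ((a ^ 2 + b ^ 2 : ℕ) : K) = 0 := by rw [hab]; exact CharP.cast_eq_zero K p
    push_cast at h
    linear_combination h - (b : K) ^ 2 * ht
  rcases mul_eq_zero.1 h0 with h | h
  · exact ⟨a, b, by exact_mod_cast hab, by exact_mod_cast h⟩
  · exact ⟨a, -b, by rw [neg_sq]; exact_mod_cast hab, by push_cast; exact h⟩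

theorem frobeniusTwist_quarticJacobiSymbol_of_one [Fact p.Prime] (hp4 : p % 4 = 1) (a : ℤ) {t : K}
    (ht : t ^ 2 = -1) (ha : (a : K) ^ 2 + 1 ≠ 0) :
    ∃ r : ℕ, quarticJacobiSymbol ⟨a, 1⟩ (p : GaussianInt) = gaussI ^ r ∧
      ∀ w : K, w ^ 4 * (a - t) = a + t → FrobeniusTwist p w (t ^ r) := by
  have hpp : p.Prime := Fact.out
  have hfac : ((a : K) + t) * (a - t) = a ^ 2 + 1 := by linear_combination -ht
  have hp1 : (a : K) + t ≠ 0 := fun h => ha (by rw [← hfac, h, zero_mul])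
  have hm1 : (a : K) - t ≠ 0 := fun h => ha (by rw [← hfac, h, mul_zero])
  have hfrob : (a : K) ^ p = a := map_intCast (frobenius K p) a
  have hpe : 4 * ((p - 1) / 4) = p - 1 := by omega
  have ht' : (-t) ^ 2 = -1 := by rw [neg_sq, ht]
  have htp : t ^ p = t := by
    have : p = 2 * (2 * ((p - 1) / 4)) + 1 := by omega
    rw [this, pow_succ, pow_mul, ht, pow_mul]
    simp
  have hA : ((a : K) + t) ^ (4 * ((p - 1) / 4)) = 1 := by
    apply mul_right_cancel₀ hp1
    rw [hpe, pow_sub_one_mul hpp.ne_zero, add_pow_char, hfrob, htp, one_mul]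
  have hB : ((a : K) - t) ^ (4 * ((p - 1) / 4)) = 1 := by
    apply mul_right_cancel₀ hm1
    rw [hpe, pow_sub_one_mul hpp.ne_zero, sub_pow_char, hfrob, htp, one_mul]
  obtain ⟨x, y, hxy, hroot⟩ := exists_sq_add_sq_and_root (K := K) hp4 ht
  have hn1 : (Zsqrtd.norm (⟨x, y⟩ : GaussianInt)).natAbs = p := by
    rw [Zsqrtd.norm_def]
    have : x * x - -1 * y * y = (p : ℤ) := by linear_combination hxy
    simp only [this, Int.natAbs_natCast]
  have hn2 : (Zsqrtd.norm (⟨x, -y⟩ : GaussianInt)).natAbs = p := by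
    rw [Zsqrtd.norm_def]
    have : x * x - -1 * -y * -y = (p : ℤ) := by linear_combination hxy
    simp only [this, Int.natAbs_natCast]
  have hprime1 : Prime (⟨x, y⟩ : GaussianInt) :=
    gaussianInt_prime_of_norm_natAbs_prime (by rw [hn1]; exact hpp)
  have hprime2 : Prime (⟨x, -y⟩ : GaussianInt) :=
    gaussianInt_prime_of_norm_natAbs_prime (by rw [hn2]; exact hpp)
  have v1 : gaussHom t ht ⟨a, 1⟩ = a + t := by simp [gaussHom_apply]
  have v2 : gaussHom (-t) ht' ⟨a, 1⟩ = a - t := by simp [gaussHom_apply, sub_eq_add_neg]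
  obtain ⟨r₁, hs1, hr1⟩ := quarticResidueSymbol_spec ht (α := ⟨a, 1⟩) hprime1
    (by simpa [gaussHom_apply] using hroot) (e := (p - 1) / 4) (by rw [hn1])
    (by rw [v1]; exact hp1) (by rw [v1]; exact hA)
  -- The conjugate prime is killed by `i ↦ -t`, which sends `a + i` to `a - t`.
  obtain ⟨r₂, hs2, hr2⟩ := quarticResidueSymbol_spec ht' (α := ⟨a, 1⟩) hprime2
    (by simpa [gaussHom_apply] using hroot) (e := (p - 1) / 4) (by rw [hn2])
    (by rw [v2]; exact hm1) (by rw [v2]; exact hB)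
  rw [v1] at hr1
  rw [v2] at hr2
  refine ⟨r₁ + r₂, ?_, fun w hw => Or.inl ⟨hp4, ?_⟩⟩
  · rw [quarticJacobiSymbol_eq_prod _ _ (by exact_mod_cast hpp.ne_zero) {⟨x, y⟩, ⟨x, -y⟩}
      (by simp [hprime1, hprime2])]
    · simp [hs1, hs2, pow_add]
    · simp only [Multiset.insert_eq_cons, Multiset.prod_cons, Multiset.prod_singleton]
      rw [Zsqrtd.ext_iff]
      simp only [Zsqrtd.re_mul, Zsqrtd.im_mul, Zsqrtd.re_natCast, Zsqrtd.im_natCast]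
      exact ⟨by linear_combination hxy, by ring⟩
  · have h1 : t ^ r₂ * (-t) ^ r₂ = 1 := by
      rw [← mul_pow, show t * -t = 1 by linear_combination -ht, one_pow]
    have h2 : w ^ (p - 1) = t ^ (r₁ + r₂) := by
      apply mul_right_cancel₀ (pow_ne_zero ((p - 1) / 4) hm1)
      have h3 : w ^ (p - 1) = (w ^ 4) ^ ((p - 1) / 4) := by rw [← pow_mul, hpe]
      rw [h3, ← mul_pow, hw, hr1, hr2, pow_add, mul_assoc, h1, mul_one]
    rw [← h2, pow_sub_one_mul hpp.ne_zero]

/-- Now `p` is inert and Frobenius exchanges `a + t` and `a - t`. So `(a + t)^((p²-1)/4)` is `((a -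
t)/(a + t))^((p+1)/4) = w^(-(p+1))`. -/
theorem frobeniusTwist_quarticJacobiSymbol_of_three [Fact p.Prime] (hp4 : p % 4 = 3) (a : ℤ)
    {t : K} (ht : t ^ 2 = -1) (ha : (a : K) ^ 2 + 1 ≠ 0) :
    ∃ r : ℕ, quarticJacobiSymbol ⟨a, 1⟩ (p : GaussianInt) = gaussI ^ r ∧
      ∀ w : K, w ^ 4 * (a - t) = a + t → FrobeniusTwist p w (t ^ r) := by
  have hpp : p.Prime := Fact.out
  have hfac : ((a : K) + t) * (a - t) = a ^ 2 + 1 := by linear_combination -ht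
  have hp1 : (a : K) + t ≠ 0 := fun h => ha (by rw [← hfac, h, zero_mul])
  have hm1 : (a : K) - t ≠ 0 := fun h => ha (by rw [← hfac, h, mul_zero])
  have hfrob : (a : K) ^ p = a := map_intCast (frobenius K p) a
  obtain ⟨m, hm⟩ : ∃ m, p = 4 * m + 3 := ⟨p / 4, by omega⟩
  have htp : t ^ p = -t := by
    rw [hm, show 4 * m + 3 = 2 * (2 * m + 1) + 1 by ring, pow_succ, pow_mul, ht, pow_succ, pow_mul]
    simp
  have hA : ((a : K) + t) ^ p = a - t := by
    rw [add_pow_char, hfrob, htp, sub_eq_add_neg]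
  have hB : ((a : K) - t) ^ p = a + t := by
    rw [sub_pow_char, hfrob, htp, sub_neg_eq_add]
  have he : (p * p - 1) / 4 = (p - 1) * (m + 1) := by
    rw [hm]
    apply Nat.div_eq_of_eq_mul_right (by norm_num)
    apply Nat.sub_eq_of_eq_add
    rw [show 4 * m + 3 - 1 = 4 * m + 2 by omega]
    ring
  have hprime := GaussianInt.prime_of_nat_prime_of_mod_four_eq_three p hp4
  have v1 : gaussHom t ht ⟨a, 1⟩ = a + t := by simp [gaussHom_apply]
  obtain ⟨r, hs, hr⟩ := quarticResidueSymbol_spec ht (α := ⟨a, 1⟩) hprime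
    (by rw [map_natCast]; exact CharP.cast_eq_zero K p) (e := (p - 1) * (m + 1))
    (by rw [Zsqrtd.norm_natCast, Int.natAbs_mul, Int.natAbs_natCast, he])
    (by rw [v1]; exact hp1) (by
      rw [v1]
      apply mul_right_cancel₀ hp1
      have : 4 * ((p - 1) * (m + 1)) + 1 = p * p := by
        rw [hm, show 4 * m + 3 - 1 = 4 * m + 2 by omega]
        ring
      rw [← pow_succ, this, pow_mul, hA, hB, one_mul])
  rw [v1] at hr
  refine ⟨r, ?_, fun w hw => Or.inr ⟨hp4, ?_⟩⟩
  · rw [quarticJacobiSymbol_eq_prod _ _ hprime.ne_zero {(p : GaussianInt)} (by simpa using hprime)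
      (by simp)]
    simpa using hs
  · apply mul_right_cancel₀ (pow_ne_zero (m + 1) hm1)
    have h1 : w * w ^ p = (w ^ 4) ^ (m + 1) := by
      rw [← pow_succ', ← pow_mul, hm]
      congr 1
    rw [mul_assoc (t ^ r), h1, mul_assoc, ← mul_pow, hw, ← hr, pow_mul, ← mul_pow,
      pow_sub_one_mul hpp.ne_zero, hA, one_mul]

theorem frobeniusTwist_quarticJacobiSymbol [Fact p.Prime] (hp : p ≠ 2) (a : ℤ) {t : K}
    (ht : t ^ 2 = -1) (ha : (a : K) ^ 2 + 1 ≠ 0) :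
    ∃ r : ℕ, quarticJacobiSymbol ⟨a, 1⟩ (p : GaussianInt) = gaussI ^ r ∧
      ∀ w : K, w ^ 4 * (a - t) = a + t → FrobeniusTwist p w (t ^ r) := by
  have hodd : p % 2 = 1 := (Nat.Prime.mod_two_eq_one_iff_ne_two (Fact.out : p.Prime)).2 hp
  rcases (by omega : p % 4 = 1 ∨ p % 4 = 3) with h | h
  · exact frobeniusTwist_quarticJacobiSymbol_of_one h a ht ha
  · exact frobeniusTwist_quarticJacobiSymbol_of_three h a ht ha

end Gaussian

/-! ### Passing from `p`-integral rationals to `K` -/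

section Reduction

/-- `x` is a `p`-integral rational number with residue `y` in the field `K` of characteristic
`p`. -/
def Reduces {K : Type*} [Field K] (x : ℚ) (y : K) : Prop :=
  ∃ a b : ℤ, (b : K) ≠ 0 ∧ x * b = a ∧ y * b = a

namespace Reduces

variable {K : Type*} [Field K] {x x' : ℚ} {y y' : K}

theorem intCast (n : ℤ) : Reduces (n : ℚ) (n : K) := ⟨n, 1, by simp, by simp, by simp⟩

theorem natCast (n : ℕ) : Reduces (n : ℚ) (n : K) := by simpa using intCast (K := K) n

theorem one : Reduces (1 : ℚ) (1 : K) := by simpa using natCast (K := K) 1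

theorem mul (h : Reduces x y) (h' : Reduces x' y') : Reduces (x * x') (y * y') := by
  obtain ⟨a, b, hb, h1, h2⟩ := h
  obtain ⟨a', b', hb', h1', h2'⟩ := h'
  refine ⟨a * a', b * b', ?_, ?_, ?_⟩ <;> push_cast
  · exact mul_ne_zero hb hb'
  · rw [mul_mul_mul_comm, h1, h1']
  · rw [mul_mul_mul_comm, h2, h2']

theorem add (h : Reduces x y) (h' : Reduces x' y') : Reduces (x + x') (y + y') := by
  obtain ⟨a, b, hb, h1, h2⟩ := h
  obtain ⟨a', b', hb', h1', h2'⟩ := h'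
  refine ⟨a * b' + a' * b, b * b', ?_, ?_, ?_⟩ <;> push_cast
  · exact mul_ne_zero hb hb'
  · linear_combination (b' : ℚ) * h1 + b * h1'
  · linear_combination (b' : K) * h2 + b * h2'

theorem neg (h : Reduces x y) : Reduces (-x) (-y) := by
  simpa using (intCast (K := K) (-1)).mul h

theorem sub (h : Reduces x y) (h' : Reduces x' y') : Reduces (x - x') (y - y') := by
  simpa only [sub_eq_add_neg] using h.add h'.neg

theorem pow (h : Reduces x y) (n : ℕ) : Reduces (x ^ n) (y ^ n) := by
  induction n with
  | zero => simpa using one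
  | succ n ih => simpa only [pow_succ] using ih.mul h

theorem inv (h : Reduces x y) (hy : y ≠ 0) : Reduces x⁻¹ y⁻¹ := by
  obtain ⟨a, b, hb, h1, h2⟩ := h
  have ha : (a : K) ≠ 0 := by rw [← h2]; exact mul_ne_zero hy hb
  have hb0 : (b : ℚ) ≠ 0 := by
    rw [Int.cast_ne_zero]; rintro rfl; simp at hb
  have ha0 : (a : ℚ) ≠ 0 := by
    rw [Int.cast_ne_zero]; rintro rfl; simp at ha
  have hx : x ≠ 0 := by rintro rfl; rw [zero_mul] at h1; exact ha0 h1.symm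
  refine ⟨b, a, ha, ?_, ?_⟩
  · rw [← h1, inv_mul_cancel_left₀ hx]
  · rw [← h2, inv_mul_cancel_left₀ hy]

theorem div (h : Reduces x y) (h' : Reduces x' y') (hy : y' ≠ 0) : Reduces (x / x') (y / y') := by
  simpa only [div_eq_mul_inv] using h.mul (h'.inv hy)

theorem sum {ι : Type*} (s : Finset ι) {f : ι → ℚ} {g : ι → K} (h : ∀ i ∈ s, Reduces (f i) (g i)) :
    Reduces (∑ i ∈ s, f i) (∑ i ∈ s, g i) := by
  classical
  induction s using Finset.induction_on with
  | empty => simpa using natCast (K := K) 0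
  | insert i s hi ih =>
    rw [Finset.sum_insert hi, Finset.sum_insert hi]
    exact (h i (by simp)).add (ih fun j hj => h j (by simp [hj]))

theorem pCongr {p : ℕ} [CharP K p] (h : Reduces x y) (h' : Reduces x' y) : pCongr p x x' := by
  obtain ⟨a, b, hb, h1, h2⟩ := h.sub h'
  rw [sub_self, zero_mul] at h2
  obtain ⟨d, rfl⟩ := (CharP.intCast_eq_zero_iff K p a).1 h2.symm
  have hb0 : (b : ℚ) ≠ 0 := by
    rw [Int.cast_ne_zero]; rintro rfl; simp at hb
  refine ⟨d / b, fun hdvd => hb ?_, ?_⟩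
  · rw [CharP.intCast_eq_zero_iff K p]
    rw [← Rat.divInt_eq_div] at hdvd
    exact (Int.natCast_dvd_natCast.2 hdvd).trans (Rat.den_dvd d b)
  · push_cast at h1
    rw [← mul_div_assoc, ← h1, mul_div_cancel_right₀ _ hb0]

/-- The residue is written with the integer representative used in `quarticSymbolAt`, so that symbol
and sums involve the same element of `K`. -/
theorem of_mem_pIntegers {p : ℕ} [Fact p.Prime] [CharP K p] (hx : x ∈ pIntegers p) :
    Reduces x (((x : ZMod p).val : ℤ) : K) := by
  have hden : ((x.den : ℕ) : ZMod p) ≠ 0 := by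
    rw [Ne, ZMod.natCast_eq_zero_iff]; exact hx
  refine ⟨x.num, x.den, ?_, ?_, ?_⟩
  · rw [Int.cast_natCast, Ne, CharP.cast_eq_zero_iff K p]; exact hx
  · rw [Int.cast_natCast, Rat.mul_den_eq_num]
  · have h : (x : ZMod p) * x.den = x.num := by
      rw [Rat.cast_def, div_mul_cancel₀ _ hden]
    have h' := congrArg (ZMod.castHom (dvd_refl p) K) h
    rw [map_mul, map_natCast, map_intCast, ← ZMod.natCast_zmod_val (x : ZMod p), map_natCast] at h'
    simpa using h'

end Reduces

end Reduction

end QuarticSum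

/-! ### Proof of the theorem -/

open QuarticSum in
theorem theorem2p1 (p : ℕ) [Fact p.Prime] (hp : p ≠ 2) (c : ℚ) (hc : c ∈ pIntegers p)
    (hc0 : ¬ pCongr p (c * (c ^ 2 + 1)) 0) :
    (∃! r : Fin 4, c ∈ quarticClass p (r : ℕ)) ∧
    ((c ∈ quarticClass p 0 →
        pCongr p ((legendreSym p 2 : ℚ) * ∑ k ∈ Finset.range (p / 4 + 1),
          ((4 * k).choose (2 * k) : ℚ) * (c ^ 2 / (16 * (c ^ 2 + 1))) ^ k) 1) ∧
      (c ∈ quarticClass p 1 →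
        pCongr p ((legendreSym p 2 : ℚ) * ∑ k ∈ Finset.range (p / 4 + 1),
          ((4 * k).choose (2 * k) : ℚ) * (c ^ 2 / (16 * (c ^ 2 + 1))) ^ k) c) ∧
      (c ∈ quarticClass p 2 →
        pCongr p ((legendreSym p 2 : ℚ) * ∑ k ∈ Finset.range (p / 4 + 1),
          ((4 * k).choose (2 * k) : ℚ) * (c ^ 2 / (16 * (c ^ 2 + 1))) ^ k) (-1)) ∧
      (c ∈ quarticClass p 3 →
        pCongr p ((legendreSym p 2 : ℚ) * ∑ k ∈ Finset.range (p / 4 + 1),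
          ((4 * k).choose (2 * k) : ℚ) * (c ^ 2 / (16 * (c ^ 2 + 1))) ^ k) (-c))) ∧
    ((c ∈ quarticClass p 0 →
        pCongr p (∑ k ∈ Finset.range (p / 4 + 1),
          ((4 * k).choose (2 * k) : ℚ) * (1 / (16 * (c ^ 2 + 1)) ^ k)) 1) ∧
      (c ∈ quarticClass p 1 →
        pCongr p (∑ k ∈ Finset.range (p / 4 + 1),
          ((4 * k).choose (2 * k) : ℚ) * (1 / (16 * (c ^ 2 + 1)) ^ k)) (-(1 / c))) ∧
      (c ∈ quarticClass p 2 →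
        pCongr p (∑ k ∈ Finset.range (p / 4 + 1),
          ((4 * k).choose (2 * k) : ℚ) * (1 / (16 * (c ^ 2 + 1)) ^ k)) (-1)) ∧
      (c ∈ quarticClass p 3 →
        pCongr p (∑ k ∈ Finset.range (p / 4 + 1),
          ((4 * k).choose (2 * k) : ℚ) * (1 / (16 * (c ^ 2 + 1)) ^ k)) (1 / c))) := by
  set K := AlgebraicClosure (ZMod p)
  obtain ⟨t, ht⟩ := IsAlgClosed.exists_pow_nat_eq (-1 : K) (n := 2) (by norm_num)
  obtain ⟨η, hη⟩ := IsAlgClosed.exists_pow_nat_eq (-1 : K) (n := 4) (by norm_num)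
  have h2 : (2 : K) ≠ 0 := two_ne_zero_of_charP hp
  have ht0 : t ≠ 0 := by rintro rfl; norm_num at ht
  set a : ℤ := ((c : ZMod p).val : ℤ) with ha
  set d : K := (a : K) with hd
  have hcd : Reduces c d := Reduces.of_mem_pIntegers hc
  have hne : d * (d ^ 2 + 1) ≠ 0 := fun h => hc0 (by
    have h1 := hcd.mul ((hcd.pow 2).add Reduces.one)
    rw [h] at h1
    exact h1.pCongr (by simpa using Reduces.natCast (K := K) 0))
  have hd0 : d ≠ 0 := left_ne_zero_of_mul hne
  have hd1 : d ^ 2 + 1 ≠ 0 := right_ne_zero_of_mul hne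
  obtain ⟨r, hr, htw⟩ := frobeniusTwist_quarticJacobiSymbol hp a ht hd1
  have hsym : quarticSymbolAt p c 1 = gaussI ^ r := by
    have : Fact (1 < p) := ⟨(Fact.out : p.Prime).one_lt⟩
    rw [← hr, quarticSymbolAt, Rat.cast_one, ZMod.val_one, Nat.cast_one]
  have hdt : d - t ≠ 0 := fun h => hd1 (by linear_combination (d + t) * h + ht)
  obtain ⟨w, hw⟩ := IsAlgClosed.exists_pow_nat_eq ((d + t) / (d - t)) (n := 4) (by norm_num)
  have hw' : w ^ 4 * (d - t) = d + t := by rw [hw, div_mul_cancel₀ _ hdt]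
  -- The exponent `r` is only determined modulo 4; applying `i ↦ t` identifies `t ^ r` with `t ^ j`.
  have hclass : ∀ j : ℕ, c ∈ quarticClass p j → FrobeniusTwist p w (t ^ j) := by
    intro j hj
    have := congrArg (gaussHom t ht) (hsym.symm.trans hj.2)
    rw [map_pow, map_pow, gaussHom_gaussI] at this
    exact this ▸ htw w hw'
  have h16 : (16 : K) ≠ 0 := by
    rw [show (16 : K) = 2 ^ 4 by norm_num]; exact pow_ne_zero _ h2
  have hden : Reduces (16 * (c ^ 2 + 1)) (16 * (d ^ 2 + 1)) := by
    simpa using (Reduces.natCast (K := K) 16).mul ((hcd.pow 2).add Reduces.one)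
  have hden0 : 16 * (d ^ 2 + 1) ≠ 0 := mul_ne_zero h16 hd1
  have hS1 : Reduces ((legendreSym p 2 : ℚ) * ∑ k ∈ Finset.range (p / 4 + 1),
          ((4 * k).choose (2 * k) : ℚ) * (c ^ 2 / (16 * (c ^ 2 + 1))) ^ k)
      (2 ^ (p / 2) * ∑ k ∈ Finset.range (p / 4 + 1),
          ((4 * k).choose (2 * k) : K) * (d ^ 2 / (16 * (d ^ 2 + 1))) ^ k) := by
    rw [← legendreSym_two_cast (p := p)]
    exact (Reduces.intCast _).mul (Reduces.sum _ fun k _ =>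
      (Reduces.natCast _).mul (((hcd.pow 2).div hden hden0).pow k))
  have hS2 : Reduces (∑ k ∈ Finset.range (p / 4 + 1),
          ((4 * k).choose (2 * k) : ℚ) * (1 / (16 * (c ^ 2 + 1)) ^ k))
      (∑ k ∈ Finset.range (p / 4 + 1),
          ((4 * k).choose (2 * k) : K) * (1 / (16 * (d ^ 2 + 1)) ^ k)) :=
    Reduces.sum _ fun k _ =>
      (Reduces.natCast _).mul (Reduces.one.div (hden.pow k) (pow_ne_zero _ hden0))
  have f1 := fun Z (hZ : FrobeniusTwist p w Z) => two_pow_mul_sum_of_sq hp ht hd1 hw' hZ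
  have f2 := fun Z (hZ : FrobeniusTwist p w Z) => sum_inv_of_sq hp ht hd0 hd1 hw' hη hZ
  have q0 : (t ^ 0) ^ 2 = 1 := by simp
  have q1 : (t ^ 1) ^ 2 = -1 := by simpa using ht
  have q2 : (t ^ 2) ^ 2 = 1 := by rw [ht]; norm_num
  have q3 : (t ^ 3) ^ 2 = -1 := by rw [← pow_mul, mul_comm, pow_mul, ht]; norm_num
  have hinv : Reduces (1 / c) (1 / d) := Reduces.one.div hcd hd0
  refine ⟨⟨⟨r % 4, Nat.mod_lt _ (by norm_num)⟩, ⟨hc, ?_⟩, fun j hj => ?_⟩,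
    ⟨fun h => ?_, fun h => ?_, fun h => ?_, fun h => ?_⟩,
    fun h => ?_, fun h => ?_, fun h => ?_, fun h => ?_⟩
  · rw [hsym, gaussI_pow_mod_four]
  · apply gaussI_pow_injective
    rw [← hj.2, hsym, gaussI_pow_mod_four]
  · rw [(f1 _ (hclass 0 h)).1 q0, pow_zero] at hS1
    exact hS1.pCongr Reduces.one
  · rw [(f1 _ (hclass 1 h)).2 q1, pow_one, mul_div_cancel_left₀ _ ht0] at hS1
    exact hS1.pCongr hcd
  · rw [(f1 _ (hclass 2 h)).1 q2, ht] at hS1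
    exact hS1.pCongr Reduces.one.neg
  · rw [(f1 _ (hclass 3 h)).2 q3, show t ^ 3 * d / t = -d by
      rw [div_eq_iff ht0]; linear_combination d * t * ht] at hS1
    exact hS1.pCongr hcd.neg
  · rw [(f2 _ (hclass 0 h)).1 q0, pow_zero] at hS2
    exact hS2.pCongr Reduces.one
  · rw [(f2 _ (hclass 1 h)).2 q1, show -t ^ 1 / (d * t) = -(1 / d) by
      rw [div_eq_iff (mul_ne_zero hd0 ht0), neg_mul, ← mul_assoc, one_div_mul_cancel hd0, pow_one,
        one_mul]] at hS2
    exact hS2.pCongr hinv.neg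
  · rw [(f2 _ (hclass 2 h)).1 q2, ht] at hS2
    exact hS2.pCongr Reduces.one.neg
  · rw [(f2 _ (hclass 3 h)).2 q3, show -t ^ 3 / (d * t) = 1 / d by
      rw [div_eq_iff (mul_ne_zero hd0 ht0), ← mul_assoc, one_div_mul_cancel hd0]
      linear_combination -t * ht] at hS2
    exact hS2.pCongr hinv
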